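/- Let $G=(V,E,\Theta)$ be a weighted graph with $n=|V|\ge 1$ vertices and real edge weights $\theta_{jk}$, and let $|G\rangle=\big[\prod_{(j,k)\in E}\Lambda_{jk}(\theta_{jk})\big]|+\rangle^{\otimes n}$ be its weighted graph state, where $\Lambda_{jk}(\theta)$ is the controlled-$Z$ rotation multiplying a computational basis vector by $e^{i\theta}$ if both qubits $j,k$ are $1$ and fixing it otherwise. Let $\mathscr A=\{A_1,\dots,A_m\}$ be an independence cover with pairwise disjoint members, i.e. independent sets of $G$ that partition $V$. For $k\in A_l$ and $z\in\{0,1\}^{A_l^c}$ put $\alpha_k(z)=\sum_{j\in C_k}\theta_{jk}z_j$, where $C_k$ is the set of neighbours of $k$, let $|\alpha\rangle=(|0\rangle+e^{i\alpha}|1\rangle)/\sqrt2$, and define $$Q_k=\bigoplus_{z}|\alpha_k(z)\rangle\langle\alpha_k(z)|_k\otimes|z\rangle\langle z|_{A_l^c},\qquad P_l=\prod_{k\in A_l}Q_k,\qquad \Omega(\mathscr A)=\frac1m\sum_{l=1}^mP_l ,$$ where $Q_k$ acts as the identity on the qubits of $A_l\setminus\{k\}$. In the $N$-random sampling test of an operator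 $0\le\Omega\le I$, one chooses uniformly at random $N$ of $N+1$ copies, applies the measurement $\{\Omega,I-\Omega\}$ to each of them, and passes if all $N$ outcomes are $\Omega$. For a joint state $\rho$ of the $N+1$ copies, let $p_\rho$ be the probability of passing (averaged over the random choice) and $\sigma_\rho$ the state of the remaining copy conditioned on passing. Then: 1. For every $l$, $P_l$ is the acceptance operator of the following adaptive measurement: measure all qubits of $A_l^c$ in the $Z$ basis, obtaining $z$; then measure every $k\in A_l$ in the basis $\{|\alpha_k(z)\rangle,|\alpha_k(z)+\pi\rangle\}$; accept if all outcomes on $A_l$ are $|\alpha_k(z)\rangle$. 2. $0\le\Omega(\mathscr A)\le I$, $\Omega(\mathscr A)\ge|G\rangle\langle G|$, and the spectral gap is $\nu(\Omega(\mathscr A)):=1-\|\Omega(\mathscr A)-|G\rangle\langle G|\|=\frac1m$, where $\|\cdot\|$ is the operator norm. 3. For every $N$, the state $|G\rangle^{\otimes(N+1)}$ passes the $N$-random sampling test of $\Omega(\mathscr A)$ with probability $1$. 4. For every $N\ge1$, every $\beta>0$ and every density operator $\rho$ on the $N+1$ copies (no i.i.d. or product assumption), if $p_\rho\ge\beta$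 then $$\langle G|\sigma_\rho|G\rangle\ \ge\ 1-\frac{m(1-\beta)}{N\beta}.$$ (That is, the bound holds with significance level $\beta$: a joint state violating it passes the test with probability less than $\beta$.) -/

import Mathlib

open scoped ComplexOrder

noncomputable section

/-- A weighted graph on the vertex set `V`: a simple graph together with a real weight for every
unordered pair of vertices, which is zero on the pairs that are not edges. -/
structure WeightedGraph (V : Type*) where
  graph : SimpleGraph V
  weight : Sym2 V → ℝ
  weight_eq_zero : ∀ e : Sym2 V, e ∉ graph.edgeSet → weight e = 0

/-- The rank-one operator `|ψ⟩⟨ψ|`. -/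
def ketBra {d : Type*} (ψ : d → ℂ) : Matrix d d ℂ :=
  Matrix.vecMulVec ψ (star ψ)

/-- The expectation value `⟨ψ|σ|ψ⟩` (its real part; it is real for Hermitian `σ`).  When `ψ` is a
unit vector and `σ` is a density operator, this is the fidelity of `σ` with `ψ`. -/
def fidelityWith {d : Type*} [Fintype d] (ψ : d → ℂ) (σ : Matrix d d ℂ) : ℝ :=
  (star ψ ⬝ᵥ Matrix.mulVec σ ψ).re

/-- The tensor product `⊗ᵢ Mᵢ` of operators, in the product basis, which is indexed by the
functions `ι → κ`. -/
def tensorOp {ι κ : Type*} [Fintype ι] (M : ι → Matrix κ κ ℂ) : Matrix (ι → κ) (ι → κ) ℂ :=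
  Matrix.of fun x y => ∏ i, M i (x i) (y i)

theorem tensorOp_mul {ι κ : Type*} [Fintype ι] [DecidableEq ι] [Fintype κ]
    (M M' : ι → Matrix κ κ ℂ) :
    tensorOp M * tensorOp M' = tensorOp fun i => M i * M' i := by
  ext x y
  simp only [tensorOp, Matrix.mul_apply, Matrix.of_apply, ← Finset.prod_mul_distrib]
  rw [Finset.prod_univ_sum, Fintype.piFinset_univ]

/-- The qubit state `|α⟩ = (|0⟩ + e^{iα}|1⟩)/√2`. -/
def phaseKet (α : ℝ) : Fin 2 → ℂ :=
  ![1 / (Real.sqrt 2 : ℂ), Complex.exp (Complex.I * (α : ℂ)) / (Real.sqrt 2 : ℂ)]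

/-- The projection `|b⟩⟨b|` on a vector of the `Z` basis of one qubit. -/
def zProj (b : Fin 2) : Matrix (Fin 2) (Fin 2) ℂ :=
  Matrix.single b b 1

/-- A density operator: positive semidefinite of trace one. -/
structure IsDensityOperator {d : Type*} [Fintype d] (ρ : Matrix d d ℂ) : Prop where
  posSemidef : ρ.PosSemidef
  trace_eq_one : ρ.trace = 1

/-- `{Ω, I - Ω}` is a two-outcome POVM, that is, `0 ≤ Ω ≤ I`. -/
def IsTestOperator {d : Type*} [Fintype d] [DecidableEq d] (Ω : Matrix d d ℂ) : Prop :=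
  Ω.PosSemidef ∧ (1 - Ω).PosSemidef

open scoped Matrix.Norms.L2Operator in
/-- The spectral gap `ν(Ω) = 1 - ‖Ω - |ψ⟩⟨ψ|‖` relative to the target state `ψ`, where `‖·‖` is the
operator norm for the Euclidean norm, i.e. the largest singular value. -/
def spectralGap {d : Type*} [Fintype d] [DecidableEq d] (ψ : d → ℂ) (Ω : Matrix d d ℂ) : ℝ :=
  1 - ‖Ω - ketBra ψ‖

namespace RandomSampling

variable {d : Type*} [Fintype d] [DecidableEq d] {N : ℕ}

/-- The operator on `N + 1` copies for "all copies except the `j`-th one are tested with outcome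
`Ω`": it is `Ω` on every copy other than `j` and `I` on the `j`-th copy. -/
def passOp (Ω : Matrix d d ℂ) (j : Fin (N + 1)) :
    Matrix (Fin (N + 1) → d) (Fin (N + 1) → d) ℂ :=
  tensorOp fun i => if i = j then 1 else Ω

/-- The partial trace over all copies except the `j`-th one. -/
def reduceTo (j : Fin (N + 1)) (M : Matrix (Fin (N + 1) → d) (Fin (N + 1) → d) ℂ) :
    Matrix d d ℂ :=
  Matrix.of fun a b => ∑ w : Fin N → d, M (j.insertNth a w) (j.insertNth b w)

/-- The probability that the joint state `ρ` of `N + 1` copies passes the `N`-random sampling test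
of `Ω`: the `N` copies to be tested (equivalently, the copy `j` that is kept) are chosen uniformly
at random, and the test is passed if all `N` outcomes are `Ω`. -/
def passProb (Ω : Matrix d d ℂ) (ρ : Matrix (Fin (N + 1) → d) (Fin (N + 1) → d) ℂ) : ℝ :=
  ((N : ℝ) + 1)⁻¹ * ∑ j : Fin (N + 1), (Matrix.trace (passOp Ω j * ρ)).re

/-- The state of the remaining copy, conditioned on the event that the `N`-random sampling test of
`Ω` is passed. -/
def remainingState (Ω : Matrix d d ℂ) (ρ : Matrix (Fin (N + 1) → d) (Fin (N + 1) → d) ℂ) :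
    Matrix d d ℂ :=
  ((passProb Ω ρ : ℝ) : ℂ)⁻¹ •
    (((N : ℂ) + 1)⁻¹ • ∑ j : Fin (N + 1), reduceTo j (passOp Ω j * ρ))

end RandomSampling

namespace WeightedGraph

variable {V : Type*} [Fintype V] [DecidableEq V]

/-- The controlled-`Z` rotation `Λ_{jk}(θ)` on the pair `e = {j, k}`: it multiplies the basis vector
`|x⟩` by `e^{iθ}` if both qubits of `e` are in the state `1`, and fixes it otherwise. -/
def controlledRotation (e : Sym2 V) (θ : ℝ) : Matrix (V → Fin 2) (V → Fin 2) ℂ :=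
  Matrix.diagonal fun x =>
    open scoped Classical in
    if ∀ v ∈ e, x v = 1 then Complex.exp (Complex.I * (θ : ℂ)) else 1

theorem controlledRotation_commute (e e' : Sym2 V) (θ θ' : ℝ) :
    Commute (controlledRotation e θ) (controlledRotation e' θ') := by
  simp only [controlledRotation, Commute, SemiconjBy, Matrix.diagonal_mul_diagonal, mul_comm]

/-- The weighted graph state `|G⟩ = (∏_{e ∈ E} Λ_e(θ_e)) |+⟩^{⊗n}`, as a vector in the `n`-qubit
space, whose computational basis is indexed by `V → Fin 2`. -/
def state (G : WeightedGraph V) [DecidableRel G.graph.Adj] : (V → Fin 2) → ℂ :=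
  Matrix.mulVec
    (G.graph.edgeFinset.noncommProd (fun e => controlledRotation e (G.weight e))
      fun _ _ _ _ _ => controlledRotation_commute _ _ _ _)
    (fun x => ∏ v, phaseKet 0 (x v))

/-- The angle `α_k(z) = ∑_{j ∈ C_k} θ_{jk} z_j` for the outcomes `z` of the `Z` measurements off
`A`, where `C_k` is the set of neighbours of `k` (disjoint from `A` if `A` is independent and
`k ∈ A`). -/
def angle (G : WeightedGraph V) [DecidableRel G.graph.Adj] (A : Finset V)
    (z : {v // v ∉ A} → Fin 2) (k : V) : ℝ :=
  ∑ j : {v // v ∉ A}, if G.graph.Adj j k then G.weight s(j, k) * ((z j).val : ℝ) else 0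

/-- The tensor factors of `|α_k(z)⟩⟨α_k(z)|_k ⊗ |z⟩⟨z|_{Aᶜ}`, which is the identity on the qubits
of `A` other than `k`. -/
def qFactor (G : WeightedGraph V) [DecidableRel G.graph.Adj] (A : Finset V) (k : V)
    (z : {v // v ∉ A} → Fin 2) (v : V) : Matrix (Fin 2) (Fin 2) ℂ :=
  if h : v ∈ A then (if v = k then ketBra (phaseKet (G.angle A z k)) else 1) else zProj (z ⟨v, h⟩)

/-- The projection `Q_k = ⊕_z |α_k(z)⟩⟨α_k(z)|_k ⊗ |z⟩⟨z|_{Aᶜ}` for `k ∈ A`. -/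
def qProj (G : WeightedGraph V) [DecidableRel G.graph.Adj] (A : Finset V) (k : V) :
    Matrix (V → Fin 2) (V → Fin 2) ℂ :=
  ∑ z : {v // v ∉ A} → Fin 2, tensorOp (G.qFactor A k z)

theorem qProj_commute (G : WeightedGraph V) [DecidableRel G.graph.Adj] (A : Finset V) {k k' : V}
    (hk : k ≠ k') : Commute (G.qProj A k) (G.qProj A k') := by
  refine Commute.sum_left _ _ _ fun z _ => Commute.sum_right _ _ _ fun z' _ => ?_
  simp only [Commute, SemiconjBy, tensorOp_mul]
  congr 1
  funext v
  by_cases hv : v ∈ A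
  · by_cases h1 : v = k
    · have h2 : v ≠ k' := fun h => hk (h1.symm.trans h)
      simp [qFactor, hv, h2]
    · simp [qFactor, hv, h1]
  · by_cases hz : z ⟨v, hv⟩ = z' ⟨v, hv⟩
    · simp [qFactor, hv, hz]
    · simp [qFactor, hv, zProj, Matrix.single_mul_single_of_ne, hz, Ne.symm hz]

/-- The projection `P = ∏_{k ∈ A} Q_k`. -/
def pProj (G : WeightedGraph V) [DecidableRel G.graph.Adj] (A : Finset V) :
    Matrix (V → Fin 2) (V → Fin 2) ℂ :=
  A.noncommProd (G.qProj A) fun _ _ _ _ h => G.qProj_commute A h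

/-- The operator for acceptance in the adaptive measurement for `A`: every qubit off `A` is measured
in the `Z` basis, with outcomes `z`, then every `k ∈ A` is measured in the basis
`{|α_k(z)⟩, |α_k(z) + π⟩}`, and one accepts if every outcome on `A` is `|α_k(z)⟩`. -/
def adaptiveAcceptOp (G : WeightedGraph V) [DecidableRel G.graph.Adj] (A : Finset V) :
    Matrix (V → Fin 2) (V → Fin 2) ℂ :=
  ∑ z : {v // v ∉ A} → Fin 2, tensorOp fun v =>
    if h : v ∈ A then ketBra (phaseKet (G.angle A z v)) else zProj (z ⟨v, h⟩)

/-- The test operator `Ω(𝒜) = ∑_l P_l / m`. -/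
def testOp (G : WeightedGraph V) [DecidableRel G.graph.Adj] {m : ℕ} (A : Fin m → Finset V) :
    Matrix (V → Fin 2) (V → Fin 2) ℂ :=
  ∑ l, ((m : ℂ)⁻¹) • G.pProj (A l)

/-- An independence cover with pairwise disjoint members: independent sets `A_1, …, A_m` of the
graph that partition the vertex set. -/
structure IsIndependenceCover {V : Type*} (G : WeightedGraph V) {m : ℕ} (A : Fin m → Finset V) :
    Prop where
  indep : ∀ l, G.graph.IsIndepSet (A l : Set V)
  cover : ∀ v, ∃ l, v ∈ A l
  disjoint : ∀ l l', l ≠ l' → Disjoint (A l) (A l')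

end WeightedGraph

end

/-! Every operator in the theorem is diagonal in one orthonormal basis, the weighted graph basis.
Its vectors are the columns of `graphBasis`, which is the diagonal of the edge phases times a
Hadamard gate on each qubit; the column with label `0` is the graph state. For independent `A`, each
edge meeting `A` has exactly one end in `A`, so the phases of these edges turn `|+⟩` at `k` into
`|α_k(z)⟩`, while all other phases depend only on `z` and cancel. Hence `P_l` projects onto the
labels vanishing on `A_l` (`pProj_eq_conjDiag`), and the eigenvalue of the test operator at `s` is
the fraction of the `A_l` on which `s` vanishes. It is `1` at `s = 0`, at most `1 - 1/m` elsewhere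
because the sets cover, and equal to `1 - 1/m` at a label with a single `1` because they are
disjoint. This gives the operator bounds and the gap.

For soundness, let `p` be the passing probability and `q` the probability of passing with the
remaining copy found in the target state. The bound follows from `N (p - q) ≤ m (1 - p)`, which is
linear in `ρ`. The operators involved are diagonal in the tensor power of the basis, so it suffices
to compare eigenvalues at each tuple of labels. There only the number of nonzero labels matters, and
`sum_prod_erase_le` settles the comparison. No product structure of `ρ` enters. -/

noncomputable section

/-! ### Tensor products of operators -/

section TensorOp

variable {ι κ : Type*} [Fintype ι]

theorem tensorOp_conjTranspose (M : ι → Matrix κ κ ℂ) :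
    (tensorOp M).conjTranspose = tensorOp fun i => (M i).conjTranspose := by
  ext x y
  simp [tensorOp, Matrix.conjTranspose_apply]

theorem tensorOp_diagonal [DecidableEq κ] [DecidableEq ι] (f : ι → κ → ℂ) :
    tensorOp (fun i => Matrix.diagonal (f i)) =
      Matrix.diagonal fun x : ι → κ => ∏ i, f i (x i) := by
  ext x y
  by_cases h : x = y
  · subst h
    simp [tensorOp]
  · obtain ⟨i, hi⟩ := Function.ne_iff.1 h
    rw [Matrix.diagonal_apply_ne _ h]
    exact Finset.prod_eq_zero (Finset.mem_univ i) (Matrix.diagonal_apply_ne _ hi)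

theorem tensorOp_one [DecidableEq κ] [DecidableEq ι] :
    tensorOp (fun _ : ι => (1 : Matrix κ κ ℂ)) = 1 := by
  have h := tensorOp_diagonal (ι := ι) (κ := κ) fun _ _ => 1
  simpa using h

theorem tensorOp_mem_unitary [DecidableEq ι] [Fintype κ] [DecidableEq κ]
    {M : ι → Matrix κ κ ℂ} (hM : ∀ i, M i ∈ Matrix.unitaryGroup κ ℂ) :
    tensorOp M ∈ Matrix.unitaryGroup (ι → κ) ℂ := by
  rw [Matrix.mem_unitaryGroup_iff, Matrix.star_eq_conjTranspose, tensorOp_conjTranspose,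
    tensorOp_mul, ← tensorOp_one]
  congr 1
  funext i
  exact Matrix.mem_unitaryGroup_iff.1 (hM i)

theorem trace_tensorOp [DecidableEq ι] [Fintype κ] (M : ι → Matrix κ κ ℂ) :
    (tensorOp M).trace = ∏ i, (M i).trace := by
  simp only [Matrix.trace, Matrix.diag_apply, tensorOp, Matrix.of_apply]
  rw [Finset.prod_univ_sum, Fintype.piFinset_univ]

end TensorOp

/-! ### Operators diagonal in a fixed basis -/

/-- The operator `W diag(f) W†`. -/
def conjDiag {d : Type*} [Fintype d] [DecidableEq d] (W : Matrix d d ℂ) :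
    (d → ℝ) →ₗ[ℝ] Matrix d d ℂ where
  toFun f := W * Matrix.diagonal (fun s => (f s : ℂ)) * W.conjTranspose
  map_add' f g := by
    rw [← add_mul, ← mul_add, Matrix.diagonal_add]
    simp
  map_smul' c f := by
    have h : Matrix.diagonal (fun s => (((c • f) s : ℝ) : ℂ)) =
        c • Matrix.diagonal (fun s => (f s : ℂ)) := by
      rw [← Matrix.diagonal_smul]
      congr 1
      funext s
      simp
    rw [h, Matrix.mul_smul, Matrix.smul_mul, RingHom.id_apply]

section ConjDiag

variable {d : Type*} [Fintype d] [DecidableEq d] {W : Matrix d d ℂ}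

theorem conjDiag_apply (f : d → ℝ) :
    conjDiag W f = W * Matrix.diagonal (fun s => (f s : ℂ)) * W.conjTranspose := rfl

theorem conjDiag_one (hW : W ∈ Matrix.unitaryGroup d ℂ) : conjDiag W 1 = 1 := by
  have := Matrix.mem_unitaryGroup_iff.1 hW
  rw [Matrix.star_eq_conjTranspose] at this
  simp [conjDiag_apply, this]

theorem conjDiag_mul (hW : W ∈ Matrix.unitaryGroup d ℂ) (f g : d → ℝ) :
    conjDiag W f * conjDiag W g = conjDiag W (f * g) := by
  have h := Matrix.mem_unitaryGroup_iff'.1 hW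
  rw [Matrix.star_eq_conjTranspose] at h
  have hd : Matrix.diagonal (fun s => ((f * g) s : ℂ)) =
      Matrix.diagonal (fun s => (f s : ℂ)) * Matrix.diagonal (fun s => (g s : ℂ)) := by
    simp [Matrix.diagonal_mul_diagonal]
  simp only [conjDiag_apply, hd, mul_assoc]
  rw [← mul_assoc W.conjTranspose W, h, one_mul]

theorem trace_conjDiag (hW : W ∈ Matrix.unitaryGroup d ℂ) (f : d → ℝ) :
    (conjDiag W f).trace = ∑ s, (f s : ℂ) := by
  have h := Matrix.mem_unitaryGroup_iff'.1 hW
  rw [Matrix.star_eq_conjTranspose] at h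
  rw [conjDiag_apply, Matrix.trace_mul_comm, ← mul_assoc, h, one_mul, Matrix.trace_diagonal]

theorem conjDiag_posSemidef {f : d → ℝ} (hf : 0 ≤ f) : (conjDiag W f).PosSemidef := by
  rw [conjDiag_apply]
  refine Matrix.PosSemidef.mul_mul_conjTranspose_same ?_ W
  rw [Matrix.posSemidef_diagonal_iff]
  exact fun s => by exact_mod_cast hf s

open scoped Matrix.Norms.L2Operator in
theorem norm_conjDiag (hW : W ∈ Matrix.unitaryGroup d ℂ) (f : d → ℝ) :
    ‖conjDiag W f‖ = ‖f‖ := by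
  rw [conjDiag_apply, ← Matrix.star_eq_conjTranspose,
    CStarRing.norm_mul_mem_unitary _ (Unitary.star_mem hW), CStarRing.norm_mem_unitary_mul _ hW,
    Matrix.l2_opNorm_diagonal]
  simp [Pi.norm_def, ← nnnorm_norm]

/-- This carries the diagonalisation from one copy to several: eigenvalues multiply over the
factors. -/
theorem tensorOp_conjDiag {ι : Type*} [Fintype ι] [DecidableEq ι] (f : ι → d → ℝ) :
    tensorOp (fun i => conjDiag W (f i)) =
      conjDiag (tensorOp fun _ => W) fun x => ∏ i, f i (x i) := by
  simp only [conjDiag_apply, ← tensorOp_mul, tensorOp_conjTranspose, tensorOp_diagonal]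
  simp

theorem trace_mul_re_nonneg {M ρ : Matrix d d ℂ} (hM : M.PosSemidef) (hρ : ρ.PosSemidef) :
    0 ≤ (M * ρ).trace.re := by
  obtain ⟨B, rfl⟩ : ∃ B : Matrix d d ℂ, M = B.conjTranspose * B := by
    open scoped MatrixOrder Matrix.Norms.L2Operator in
    -- With `M = B†B`, cyclicity turns the trace into that of the positive operator `B ρ B†`.
    exact CStarAlgebra.nonneg_iff_eq_star_mul_self.1 hM.nonneg
  rw [mul_assoc, Matrix.trace_mul_comm]
  exact (Complex.le_def.1 (hρ.mul_mul_conjTranspose_same B).trace_nonneg).1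

end ConjDiag

theorem fidelityWith_eq_trace {d : Type*} [Fintype d] (ψ : d → ℂ) (σ : Matrix d d ℂ) :
    fidelityWith ψ σ = (ketBra ψ * σ).trace.re := by
  rw [fidelityWith, ketBra, Matrix.trace_mul_comm, Matrix.mul_vecMulVec, Matrix.trace_vecMulVec,
    dotProduct_comm]

/-! ### The eigenvalue inequality behind soundness -/

theorem pow_mul_add_le {m : ℝ} (hm : 1 ≤ m) (k : ℕ) : (1 - 1 / m) ^ k * (k + m) ≤ m := by
  have hm0 : 0 < m := by linarith
  have hc : 0 ≤ 1 - 1 / m := by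
    rw [sub_nonneg, div_le_one hm0]
    exact hm
  induction k with
  | zero => simp
  | succ k ih =>
    -- The left side is nonincreasing in `k` and equals `m` at `k = 0`.
    refine le_trans ?_ ih
    rw [pow_succ, mul_assoc]
    refine mul_le_mul_of_nonneg_left ?_ (pow_nonneg hc k)
    have h : (1 - 1 / m) * ((k + 1 : ℕ) + m) = (k + m) - (k + 1) / m := by
      push_cast
      field_simp
      ring
    rw [h]
    have : (0 : ℝ) ≤ (k + 1) / m := by positivity
    linarith

/-- If the `N + 1` numbers `l i` are `1` off `B` and at most `1 - 1 / m` on `B`, then the products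
with one factor left out are bounded as needed for the random sampling test. -/
theorem sum_prod_erase_le {N : ℕ} {m : ℝ} (hm : 1 ≤ m) (B : Finset (Fin (N + 1)))
    {l : Fin (N + 1) → ℝ} (h0 : ∀ i, 0 ≤ l i) (hB : ∀ i ∈ B, l i ≤ 1 - 1 / m)
    (h1 : ∀ i ∉ B, l i = 1) :
    ∑ j, (∏ i ∈ Finset.univ.erase j, l i) * ((if j ∈ B then (N : ℝ) else 0) + m) ≤
      m * (N + 1) := by
  have hm0 : 0 < m := by linarith
  have hc : 0 ≤ 1 - 1 / m := by
    rw [sub_nonneg, div_le_one hm0]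
    exact hm
  have hprod : ∀ j, ∏ i ∈ Finset.univ.erase j, l i ≤ (1 - 1 / m) ^ (B.erase j).card := by
    intro j
    rw [← Finset.prod_subset (Finset.erase_subset_erase j (Finset.subset_univ B))]
    · rw [← Finset.prod_const]
      exact Finset.prod_le_prod (fun i _ => h0 i) fun i hi => hB i (Finset.mem_of_mem_erase hi)
    · intro i hi hi'
      exact h1 i fun h => hi' (Finset.mem_erase.2 ⟨Finset.ne_of_mem_erase hi, h⟩)
  have hsum : ∑ j, (∏ i ∈ Finset.univ.erase j, l i) * ((if j ∈ B then (N : ℝ) else 0) + m) ≤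
      ∑ j, if j ∈ B then (1 - 1 / m) ^ (B.card - 1) * (N + m) else (1 - 1 / m) ^ B.card * m := by
    refine Finset.sum_le_sum fun j _ => ?_
    have h := hprod j
    split_ifs with hj
    · rw [Finset.card_erase_of_mem hj] at h
      exact mul_le_mul_of_nonneg_right h (by positivity)
    · rw [Finset.erase_eq_of_notMem hj] at h
      rw [zero_add]
      exact mul_le_mul_of_nonneg_right h hm0.le
  refine hsum.trans ?_
  rw [Finset.sum_ite, Finset.sum_const, Finset.sum_const, Finset.filter_mem_eq_inter,
    Finset.univ_inter, nsmul_eq_mul, nsmul_eq_mul]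
  have hcard : ((Finset.univ.filter fun j => j ∉ B).card : ℝ) = N + 1 - B.card := by
    have := Finset.card_filter_add_card_filter_not (s := Finset.univ) (fun j => j ∈ B)
    simp only [Finset.filter_mem_eq_inter, Finset.univ_inter, Finset.card_univ,
      Fintype.card_fin] at this
    have h' : (B.card : ℝ) + ((Finset.univ.filter fun j => j ∉ B).card : ℝ) = N + 1 := by
      exact_mod_cast this
    linarith
  rw [hcard]
  -- For empty `B` the truncated exponent `B.card - 1` is harmless, since its term has coefficient
  -- `0`. For `B.card = k + 1` the sum is exactly `(1 - 1/m)^k (k + m) (N + 1)`.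
  rcases hk : B.card with _ | k
  · simp [mul_comm]
  · have h := mul_le_mul_of_nonneg_right (pow_mul_add_le hm k) (by positivity : (0 : ℝ) ≤ N + 1)
    refine le_of_eq_of_le ?_ h
    rw [Nat.add_sub_cancel, pow_succ]
    push_cast
    field_simp
    ring

/-! ### Soundness of the random sampling test -/

namespace RandomSampling

variable {d : Type*} [Fintype d] [DecidableEq d] {N : ℕ}

/-- The partial trace is dual to tensoring with the identity on the other copies. -/
theorem trace_mul_reduceTo (E : Matrix d d ℂ) (j : Fin (N + 1))
    (X : Matrix (Fin (N + 1) → d) (Fin (N + 1) → d) ℂ) :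
    (E * reduceTo j X).trace = ((tensorOp fun i => if i = j then E else 1) * X).trace := by
  have hE : ∀ (a b : d) (w w' : Fin N → d),
      (tensorOp fun i => if i = j then E else 1) (j.insertNth a w : Fin (N + 1) → d)
        (j.insertNth b w' : Fin (N + 1) → d) = if w = w' then E a b else 0 := by
    intro a b w w'
    have h1 := congrFun₂ (tensorOp_one (ι := Fin N) (κ := d)) w w'
    rw [Matrix.one_apply] at h1
    simp only [tensorOp, Matrix.of_apply] at h1 ⊢
    rw [Fin.prod_univ_succAbove _ j]
    simp only [if_true, Fin.succAbove_ne, if_false, Fin.insertNth_apply_same,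
      Fin.insertNth_apply_succAbove, h1, mul_ite, mul_one, mul_zero]
  simp only [Matrix.trace, Matrix.diag_apply, Matrix.mul_apply, reduceTo, Matrix.of_apply]
  rw [← (Fin.insertNthEquiv (fun _ => d) j).sum_comp, Fintype.sum_prod_type]
  refine Finset.sum_congr rfl fun a _ => ?_
  have hx : ∀ x : Fin (N + 1) → d,
      ∑ y, (tensorOp fun i => if i = j then E else 1) x y * X y x =
        ∑ b, ∑ w', (tensorOp fun i => if i = j then E else 1) x (j.insertNth b w') *
          X (j.insertNth b w') x := by
    intro x
    rw [← (Fin.insertNthEquiv (fun _ => d) j).sum_comp, Fintype.sum_prod_type]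
    rfl
  simp only [hx]
  change _ = ∑ w, ∑ b, ∑ w', (tensorOp fun i => if i = j then E else 1) (j.insertNth a w)
    (j.insertNth b w') * X (j.insertNth b w') (j.insertNth a w)
  simp only [hE, ite_mul, zero_mul, Finset.sum_ite_eq, Finset.mem_univ, if_true, Finset.mul_sum]
  rw [Finset.sum_comm]

theorem fidelityWith_remainingState (ψ : d → ℂ) (Ω : Matrix d d ℂ)
    (ρ : Matrix (Fin (N + 1) → d) (Fin (N + 1) → d) ℂ) :
    fidelityWith ψ (remainingState Ω ρ) = (passProb Ω ρ)⁻¹ * (((N : ℝ) + 1)⁻¹ *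
      ∑ j : Fin (N + 1), ((tensorOp fun i => if i = j then ketBra ψ else Ω) * ρ).trace.re) := by
  have h : ∀ j : Fin (N + 1), (ketBra ψ * reduceTo j (passOp Ω j * ρ)).trace =
      ((tensorOp fun i => if i = j then ketBra ψ else Ω) * ρ).trace := by
    intro j
    rw [trace_mul_reduceTo, ← mul_assoc, passOp, tensorOp_mul]
    congr 4
    funext i
    split_ifs <;> simp
  rw [fidelityWith_eq_trace, remainingState]
  rw [Matrix.mul_smul, Matrix.mul_smul, Matrix.trace_smul, Matrix.trace_smul, Finset.mul_sum,
    Matrix.trace_sum, ← Complex.re_sum]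
  simp only [h, smul_eq_mul]
  rw [← Complex.ofReal_inv, Complex.re_ofReal_mul]
  have : ((N : ℂ) + 1)⁻¹ = (((N : ℝ) + 1)⁻¹ : ℝ) := by push_cast; rfl
  rw [this, Complex.re_ofReal_mul]

theorem one_sub_le_of_mul_sub_le {n m β p q : ℝ} (hn : 0 < n) (hm : 0 ≤ m) (hβ : 0 < β)
    (hβp : β ≤ p) (h : n * (p - q) ≤ m * (1 - p)) :
    1 - m * (1 - β) / (n * β) ≤ p⁻¹ * q := by
  have hp : 0 < p := hβ.trans_le hβp
  -- The resulting bound decreases in `p`, so its worst case is `p = β`.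
  have h1 : 1 - p⁻¹ * q ≤ m * (1 - p) / (n * p) := by
    rw [le_div_iff₀ (by positivity)]
    refine le_of_eq_of_le ?_ h
    field_simp
  have h2 : m * (1 - p) / (n * p) ≤ m * (1 - β) / (n * β) := by
    rw [div_le_div_iff₀ (by positivity) (by positivity)]
    have := mul_nonneg (mul_nonneg hm hn.le) (sub_nonneg.2 hβp)
    linarith
  linarith

/-- Soundness of the `N`-random sampling test, for a test operator that is diagonal in the same
orthonormal basis as the target state, with eigenvalue `1` on the target state and eigenvalues in
`[0, 1 - 1 / m]` on its complement. -/
theorem le_fidelityWith_remainingState {W : Matrix d d ℂ} (hW : W ∈ Matrix.unitaryGroup d ℂ)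
    {ψ : d → ℂ} {s₀ : d} (hψ : ketBra ψ = conjDiag W (Pi.single s₀ 1)) {l : d → ℝ} {m : ℝ}
    (hm : 1 ≤ m) (hl : 0 ≤ l) (hl1 : l s₀ = 1) (hlm : ∀ s, s ≠ s₀ → l s ≤ 1 - 1 / m)
    (hN : 1 ≤ N) {β : ℝ} (hβ : 0 < β)
    {ρ : Matrix (Fin (N + 1) → d) (Fin (N + 1) → d) ℂ} (hρ : IsDensityOperator ρ)
    (hpass : β ≤ passProb (conjDiag W l) ρ) :
    1 - m * (1 - β) / (N * β) ≤ fidelityWith ψ (remainingState (conjDiag W l) ρ) := by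
  have hN0 : (0 : ℝ) < N := by exact_mod_cast hN
  set U : Matrix (Fin (N + 1) → d) (Fin (N + 1) → d) ℂ := tensorOp fun _ => W with hU
  have hUu : U ∈ Matrix.unitaryGroup (Fin (N + 1) → d) ℂ := tensorOp_mem_unitary fun _ => hW
  -- At the label tuple `x`, with copy `j` kept, `a` is the eigenvalue for passing and `b` the one
  -- for passing with copy `j` found in `ψ`.
  let a : Fin (N + 1) → (Fin (N + 1) → d) → ℝ := fun j x => ∏ i ∈ Finset.univ.erase j, l (x i)
  let b : Fin (N + 1) → (Fin (N + 1) → d) → ℝ := fun j x => if x j = s₀ then a j x else 0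
  have hprod : ∀ (j : Fin (N + 1)) (g : d → ℝ) (x : Fin (N + 1) → d),
      ∏ i, (if i = j then g else l) (x i) = g (x j) * a j x := by
    intro j g x
    rw [← Finset.mul_prod_erase _ _ (Finset.mem_univ j), if_pos rfl]
    congr 1
    exact Finset.prod_congr rfl fun i hi => by rw [if_neg (Finset.ne_of_mem_erase hi)]
  have htensor : ∀ (j : Fin (N + 1)) (g : d → ℝ),
      tensorOp (fun i => if i = j then conjDiag W g else conjDiag W l) =
        conjDiag U fun x => g (x j) * a j x := by
    intro j g
    have : (fun i => if i = j then conjDiag W g else conjDiag W l) =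
        fun i => conjDiag W (if i = j then g else l) := by
      funext i
      split_ifs <;> rfl
    rw [this, tensorOp_conjDiag]
    simp_rw [hprod]
    rfl
  have ha : ∀ j, passOp (conjDiag W l) j = conjDiag U (a j) := by
    intro j
    rw [passOp, ← conjDiag_one hW, htensor]
    simp
  have hb : ∀ j, (tensorOp fun i : Fin (N + 1) => if i = j then ketBra ψ else conjDiag W l) =
      conjDiag U (b j) := by
    intro j
    rw [hψ, htensor]
    congr 1
    funext x
    simp [b, Pi.single_apply]
  let tr : ((Fin (N + 1) → d) → ℝ) → ℝ := fun f => (conjDiag U f * ρ).trace.re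
  have tr_sub : ∀ f g, tr (f - g) = tr f - tr g := fun f g => by
    simp [tr, sub_mul, Matrix.trace_sub]
  have tr_smul : ∀ (c : ℝ) f, tr (c • f) = c * tr f := fun c f => by
    simp [tr, Matrix.trace_smul]
  have tr_sum : ∀ f : Fin (N + 1) → (Fin (N + 1) → d) → ℝ, tr (∑ j, f j) = ∑ j, tr (f j) :=
    fun f => by simp [tr, Finset.sum_mul, Matrix.trace_sum]
  have tr_one : tr 1 = 1 := by simp [tr, conjDiag_one hUu, hρ.trace_eq_one]
  -- This is `N (p - q) ≤ m (1 - p)` multiplied by `N + 1`, proved pointwise on eigenvalues with the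
  -- set of copies whose label is not `s₀`.
  have key : 0 ≤ tr ((m * (N + 1)) • 1 - m • (∑ j, a j) -
      (N : ℝ) • (∑ j, a j - ∑ j, b j)) := by
    refine trace_mul_re_nonneg (conjDiag_posSemidef fun x => ?_) hρ.posSemidef
    have h := sum_prod_erase_le hm (Finset.univ.filter fun i => x i ≠ s₀) (l := fun i => l (x i))
      (fun i => hl _) (fun i hi => hlm _ (Finset.mem_filter.1 hi).2)
      (fun i hi => by
        have : x i = s₀ := by simpa using hi
        rw [this, hl1])
    have h2 : ∑ j, (∏ i ∈ Finset.univ.erase j, l (x i)) *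
        ((if j ∈ (Finset.univ.filter fun i => x i ≠ s₀) then (N : ℝ) else 0) + m) =
        m * ∑ j, a j x + N * (∑ j, a j x - ∑ j, b j x) := by
      rw [← Finset.sum_sub_distrib, Finset.mul_sum, Finset.mul_sum, ← Finset.sum_add_distrib]
      refine Finset.sum_congr rfl fun j _ => ?_
      by_cases hj : x j = s₀ <;> simp [hj, a, b] <;> ring
    rw [h2] at h
    simp only [Pi.zero_apply, Pi.sub_apply, Pi.smul_apply, Finset.sum_apply, Pi.one_apply,
      smul_eq_mul]
    linarith
  rw [tr_sub, tr_sub, tr_smul, tr_smul, tr_smul, tr_sub, tr_one, tr_sum, tr_sum] at key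
  rw [fidelityWith_remainingState]
  have hp : passProb (conjDiag W l) ρ = ((N : ℝ) + 1)⁻¹ * ∑ j, tr (a j) := by
    rw [passProb]
    simp_rw [ha]
    rfl
  simp_rw [hb]
  change _ ≤ _ * (((N : ℝ) + 1)⁻¹ * ∑ j, tr (b j))
  generalize passProb (conjDiag W l) ρ = p at *
  generalize hq : ((N : ℝ) + 1)⁻¹ * ∑ j, tr (b j) = q
  generalize ∑ j, tr (a j) = α at *
  generalize ∑ j, tr (b j) = γ at *
  have hN1 : (0 : ℝ) < N + 1 := by positivity
  have hp' : α = (N + 1) * p := by rw [hp]; field_simp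
  have hq' : γ = (N + 1) * q := by rw [← hq]; field_simp
  rw [hp', hq'] at key
  refine one_sub_le_of_mul_sub_le hN0 (by linarith) hβ hpass (le_of_mul_le_mul_left ?_ hN1)
  linarith

end RandomSampling

/-! ### Single-qubit states -/

/-- The Hadamard gate. -/
def hadamard : Matrix (Fin 2) (Fin 2) ℂ :=
  !![1 / (Real.sqrt 2 : ℂ), 1 / (Real.sqrt 2 : ℂ); 1 / (Real.sqrt 2 : ℂ), -(1 / (Real.sqrt 2 : ℂ))]

theorem one_div_sqrt_two_mul_self :
    (1 / (Real.sqrt 2 : ℂ)) * (1 / (Real.sqrt 2 : ℂ)) = 1 / 2 := by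
  rw [div_mul_div_comm, one_mul, ← Complex.ofReal_mul, Real.mul_self_sqrt (by norm_num)]
  norm_num

theorem conjTranspose_hadamard : hadamard.conjTranspose = hadamard := by
  ext i j
  fin_cases i <;> fin_cases j <;> simp [hadamard]

theorem hadamard_mem_unitary : hadamard ∈ Matrix.unitaryGroup (Fin 2) ℂ := by
  rw [Matrix.mem_unitaryGroup_iff, Matrix.star_eq_conjTranspose, conjTranspose_hadamard]
  ext i j
  fin_cases i <;> fin_cases j <;>
    simp only [hadamard, Matrix.mul_apply, Fin.sum_univ_two, Fin.zero_eta, Fin.mk_one,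
      Matrix.of_apply, Matrix.cons_val_zero, Matrix.cons_val_one, mul_neg, neg_mul, neg_neg,
      one_div_sqrt_two_mul_self] <;> norm_num

theorem conjDiag_hadamard :
    conjDiag hadamard (Pi.single 0 1) = ketBra (phaseKet 0) := by
  rw [conjDiag_apply, conjTranspose_hadamard]
  ext i j
  fin_cases i <;> fin_cases j <;>
    simp [hadamard, Matrix.mul_apply (n := Fin 2), -Matrix.cons_mul, ketBra, Matrix.vecMulVec_apply, phaseKet]

theorem phaseKet_apply (α : ℝ) (b : Fin 2) :
    phaseKet α b = Complex.exp (Complex.I * ((α * (b.val : ℝ) : ℝ) : ℂ)) * phaseKet 0 b := by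
  fin_cases b <;> simp [phaseKet, div_eq_mul_inv]

/-! ### Operators block diagonal in the outcomes `z` -/

namespace WeightedGraph

theorem IsIndependenceCover.pos {V : Type*} [Nonempty V] {G : WeightedGraph V} {m : ℕ}
    {A : Fin m → Finset V} (hA : G.IsIndependenceCover A) : 0 < m := by
  obtain ⟨l, -⟩ := hA.cover (Classical.arbitrary V)
  exact l.pos

variable {V : Type*} [Fintype V] [DecidableEq V]

/-- The direct sum `⊕_z (⊗_{v ∈ A} K z v) ⊗ |z⟩⟨z|_{Aᶜ}`. -/
def zBlock (A : Finset V) (K : ({v // v ∉ A} → Fin 2) → V → Matrix (Fin 2) (Fin 2) ℂ) :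
    Matrix (V → Fin 2) (V → Fin 2) ℂ :=
  ∑ z : {v // v ∉ A} → Fin 2, tensorOp fun v => if h : v ∈ A then K z v else zProj (z ⟨v, h⟩)

theorem zBlock_apply (A : Finset V)
    (K : ({v // v ∉ A} → Fin 2) → V → Matrix (Fin 2) (Fin 2) ℂ) (x y : V → Fin 2) :
    zBlock A K x y =
      if ∀ v ∉ A, x v = y v then ∏ v ∈ A, K (fun v => x v) v (x v) (y v) else 0 := by
  rw [zBlock, Matrix.sum_apply]
  simp only [tensorOp, Matrix.of_apply]
  -- The `Z` projections kill every block except the one whose outcome is the restriction of `x`.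
  rw [Finset.sum_eq_single fun v : {v // v ∉ A} => x v]
  · split_ifs with h
    · rw [← Finset.prod_subset (Finset.subset_univ A)]
      · exact Finset.prod_congr rfl fun v hv => by rw [dif_pos hv]
      · intro v _ hv
        rw [dif_neg hv, ← h v hv, zProj, Matrix.single_apply_same]
    · push Not at h
      obtain ⟨v, hv, hne⟩ := h
      refine Finset.prod_eq_zero (Finset.mem_univ v) ?_
      rw [dif_neg hv, zProj, Matrix.single_apply, if_neg fun h => hne h.2]
  · intro z _ hz
    obtain ⟨v, hv⟩ := Function.ne_iff.1 hz
    refine Finset.prod_eq_zero (Finset.mem_univ v.1) ?_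
    rw [dif_neg v.2, zProj, Matrix.single_apply, if_neg fun h => hv h.1]
  · exact fun h => absurd (Finset.mem_univ _) h

theorem zBlock_one (A : Finset V) : zBlock A (fun _ _ => 1) = 1 := by
  ext x y
  rw [zBlock_apply]
  by_cases hxy : x = y
  · subst hxy
    simp
  · rw [Matrix.one_apply_ne hxy]
    obtain ⟨v, hv⟩ := Function.ne_iff.1 hxy
    split_ifs with h
    · exact Finset.prod_eq_zero (i := v) (by by_contra hA; exact hv (h v hA))
        (Matrix.one_apply_ne hv)
    · rfl

theorem zBlock_mul (A : Finset V)
    (K K' : ({v // v ∉ A} → Fin 2) → V → Matrix (Fin 2) (Fin 2) ℂ) :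
    zBlock A K * zBlock A K' = zBlock A fun z v => K z v * K' z v := by
  simp only [zBlock, Finset.sum_mul_sum, tensorOp_mul]
  refine Finset.sum_congr rfl fun z _ => ?_
  rw [Finset.sum_eq_single z]
  · congr 1
    funext v
    split_ifs
    · rfl
    · simp [zProj]
  · intro z' _ hz
    obtain ⟨v, hv⟩ := Function.ne_iff.1 hz
    ext x y
    refine Finset.prod_eq_zero (Finset.mem_univ v.1) ?_
    beta_reduce
    rw [dif_neg v.2, dif_neg v.2]
    exact congrFun₂ (Matrix.single_mul_single_of_ne (1 : ℂ) _ _ _ (Ne.symm hv) 1) _ _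
  · exact fun h => absurd (Finset.mem_univ _) h

/-! ### The weighted graph basis -/

section State

variable (G : WeightedGraph V)

/-- The diagonal entry of the controlled rotation for `e` at `x`. -/
def controlledPhase (e : Sym2 V) (x : V → Fin 2) : ℂ :=
  open scoped Classical in
  if ∀ v ∈ e, x v = 1 then Complex.exp (Complex.I * (G.weight e : ℂ)) else 1

theorem controlledPhase_mul_star (e : Sym2 V) (x : V → Fin 2) :
    G.controlledPhase e x * star (G.controlledPhase e x) = 1 := by
  rw [controlledPhase]
  split_ifs
  · rw [Complex.star_def, Complex.mul_conj, Complex.normSq_eq_norm_sq, mul_comm,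
      Complex.norm_exp_ofReal_mul_I]
    simp
  · simp

theorem prod_controlledPhase_mul_star (s : Finset (Sym2 V)) (x : V → Fin 2) :
    (∏ e ∈ s, G.controlledPhase e x) * star (∏ e ∈ s, G.controlledPhase e x) = 1 := by
  rw [star_prod, ← Finset.prod_mul_distrib]
  exact Finset.prod_eq_one fun e _ => G.controlledPhase_mul_star e x

theorem noncommProd_controlledRotation (s : Finset (Sym2 V))
    (h : (s : Set (Sym2 V)).Pairwise
      (Function.onFun Commute fun e => controlledRotation e (G.weight e))) :
    s.noncommProd (fun e => controlledRotation e (G.weight e)) h =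
      Matrix.diagonal fun x => ∏ e ∈ s, G.controlledPhase e x := by
  induction s using Finset.induction_on with
  | empty => simp
  | insert e s he ih =>
    rw [Finset.noncommProd_insert_of_notMem _ _ _ _ he, ih]
    simp_rw [Finset.prod_insert he]
    exact Matrix.diagonal_mul_diagonal _ _

variable [DecidableRel G.graph.Adj]

/-- The index set `S` is separated from `A` so that the induction can add one measured vertex at a
time while the blocks stay fixed. -/
theorem noncommProd_qProj (A S : Finset V)
    (h : (S : Set V).Pairwise (Function.onFun Commute (G.qProj A))) :
    S.noncommProd (G.qProj A) h =
      zBlock A fun z v => if v ∈ S then ketBra (phaseKet (G.angle A z v)) else 1 := by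
  induction S using Finset.induction_on with
  | empty => simp [zBlock_one]
  | insert k S hk ih =>
    have hq : G.qProj A k =
        zBlock A fun z v => if v = k then ketBra (phaseKet (G.angle A z k)) else 1 := rfl
    rw [Finset.noncommProd_insert_of_notMem _ _ _ _ hk, ih, hq, zBlock_mul]
    congr 1
    funext z v
    by_cases hv : v = k
    · subst hv
      simp [hk]
    · simp [hv]

theorem pProj_eq_adaptiveAcceptOp (A : Finset V) : G.pProj A = G.adaptiveAcceptOp A := by
  refine (G.noncommProd_qProj A A _).trans ?_
  rw [zBlock, adaptiveAcceptOp]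
  refine Finset.sum_congr rfl fun z _ => ?_
  congr 1
  funext v
  split_ifs <;> rfl

/-- The phase of `|G⟩` at the computational basis vector `x`. -/
def edgePhase (x : V → Fin 2) : ℂ :=
  ∏ e ∈ G.graph.edgeFinset, G.controlledPhase e x

theorem state_apply (x : V → Fin 2) :
    G.state x = G.edgePhase x * ∏ v, phaseKet 0 (x v) := by
  have h := G.noncommProd_controlledRotation G.graph.edgeFinset
    fun _ _ _ _ _ => controlledRotation_commute _ _ _ _
  rw [state]
  refine (congrFun (congrArg (fun M => Matrix.mulVec M _) h) x).trans ?_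
  exact Matrix.mulVec_diagonal _ _ _

/-- All neighbours of `k` lie off `A`, so `angle` sees every edge at `k`; each such edge contributes
its phase exactly when `x k` and the neighbour's bit are both `1`. -/
theorem prod_incidenceFinset_controlledPhase {A : Finset V}
    (hA : G.graph.IsIndepSet (A : Set V)) {k : V} (hk : k ∈ A) (x : V → Fin 2) :
    ∏ e ∈ G.graph.incidenceFinset k, G.controlledPhase e x =
      Complex.exp (Complex.I *
        ((G.angle A (fun v => x v) k * ((x k).val : ℝ) : ℝ) : ℂ)) := by
  have h1 : ∏ e ∈ G.graph.incidenceFinset k, G.controlledPhase e x =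
      ∏ j with G.graph.Adj j k, G.controlledPhase s(j, k) x := by
    refine (Finset.prod_bij (fun j _ => s(j, k)) ?_ ?_ ?_ fun _ _ => rfl).symm
    · intro j hj
      rw [SimpleGraph.mem_incidenceFinset]
      exact ⟨(Finset.mem_filter.1 hj).2, Sym2.mem_mk_right j k⟩
    · intro j _ j' _ h
      exact Sym2.congr_left.1 h
    · intro e he
      rw [SimpleGraph.mem_incidenceFinset] at he
      obtain ⟨j, rfl⟩ := Sym2.mem_iff_exists.1 he.2
      exact ⟨j, Finset.mem_filter.2 ⟨Finset.mem_univ _, he.1.symm⟩, Sym2.eq_swap⟩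
  have h2 : G.angle A (fun v => x v) k =
      ∑ j with G.graph.Adj j k, G.weight s(j, k) * ((x j).val : ℝ) := by
    rw [Finset.sum_filter, angle, ← Finset.sum_subset (Finset.subset_univ Aᶜ)]
    · exact (Finset.sum_subtype Aᶜ (fun v => Finset.mem_compl) fun j =>
        if G.graph.Adj j k then G.weight s(j, k) * ((x j).val : ℝ) else 0).symm
    · intro j _ hj
      rw [Finset.mem_compl, not_not] at hj
      refine if_neg fun h => ?_
      exact hA hj hk h.ne h
  rw [h1, h2, Finset.sum_mul, Complex.ofReal_sum, Finset.mul_sum, Complex.exp_sum]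
  refine Finset.prod_congr rfl fun j _ => ?_
  have h01 : ∀ b : Fin 2, b = 0 ∨ b = 1 := by decide
  rcases h01 (x k) with hxk | hxk <;> rcases h01 (x j) with hxj | hxj <;>
    simp [controlledPhase, hxk, hxj]

theorem edgePhase_eq {A : Finset V} (hA : G.graph.IsIndepSet (A : Set V)) (x : V → Fin 2) :
    G.edgePhase x =
      (∏ k ∈ A, Complex.exp (Complex.I *
        ((G.angle A (fun v => x v) k * ((x k).val : ℝ) : ℝ) : ℂ))) *
      ∏ e ∈ G.graph.edgeFinset \ A.biUnion fun k => G.graph.incidenceFinset k,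
        G.controlledPhase e x := by
  rw [← Finset.prod_congr rfl fun k hk => G.prod_incidenceFinset_controlledPhase hA hk x,
    ← Finset.prod_biUnion, mul_comm, edgePhase, Finset.prod_sdiff]
  · exact Finset.biUnion_subset.2 fun k _ => G.graph.incidenceFinset_subset k
  -- An edge incident to two distinct vertices of `A` would contradict independence.
  · intro k hk k' hk' hne
    refine Finset.disjoint_left.2 fun e he he' => ?_
    rw [SimpleGraph.mem_incidenceFinset] at he he'
    obtain rfl := (Sym2.mem_and_mem_iff hne).1 ⟨he.2, he'.2⟩
    exact hA hk hk' hne he.1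

theorem adaptiveAcceptOp_apply {A : Finset V} (hA : G.graph.IsIndepSet (A : Set V))
    (x y : V → Fin 2) :
    G.adaptiveAcceptOp A x y = G.edgePhase x *
      tensorOp (fun v => if v ∈ A then ketBra (phaseKet 0) else 1) x y *
      star (G.edgePhase y) := by
  have hz : G.adaptiveAcceptOp A = zBlock A fun z v => ketBra (phaseKet (G.angle A z v)) := rfl
  rw [hz, zBlock_apply]
  split_ifs with h
  · have hxy : (fun v : {v // v ∉ A} => x v) = fun v : {v // v ∉ A} => y v :=
      funext fun v => h v v.2
    have htens : tensorOp (fun v => if v ∈ A then ketBra (phaseKet 0) else 1) x y =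
        ∏ v ∈ A, ketBra (phaseKet 0) (x v) (y v) := by
      rw [tensorOp, Matrix.of_apply, ← Finset.prod_subset (Finset.subset_univ A)]
      · exact Finset.prod_congr rfl fun v hv => by rw [if_pos hv]
      · intro v _ hv
        rw [if_neg hv, h v hv, Matrix.one_apply_eq]
    -- Edges avoiding `A` see only coordinates where `x` and `y` agree, so their phases cancel
    -- against the conjugates.
    have hrest : ∏ e ∈ G.graph.edgeFinset \ A.biUnion fun k => G.graph.incidenceFinset k,
          G.controlledPhase e y =
        ∏ e ∈ G.graph.edgeFinset \ A.biUnion fun k => G.graph.incidenceFinset k,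
          G.controlledPhase e x := by
      refine Finset.prod_congr rfl fun e he => ?_
      have hv : ∀ v ∈ e, x v = y v := by
        intro v hv
        refine h v fun hvA => (Finset.mem_sdiff.1 he).2 (Finset.mem_biUnion.2 ⟨v, hvA, ?_⟩)
        rw [SimpleGraph.mem_incidenceFinset]
        exact ⟨SimpleGraph.mem_edgeFinset.1 (Finset.mem_sdiff.1 he).1, hv⟩
      have : (∀ v ∈ e, y v = 1) ↔ ∀ v ∈ e, x v = 1 :=
        forall₂_congr fun v hve => by rw [hv v hve]
      simp only [controlledPhase, this]
    have hR := G.prod_controlledPhase_mul_star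
      (G.graph.edgeFinset \ A.biUnion fun k => G.graph.incidenceFinset k) x
    have hprod : ∏ v ∈ A,
          ketBra (phaseKet (G.angle A (fun v => x v) v)) (x v) (y v) =
        (∏ v ∈ A, Complex.exp (Complex.I *
          ((G.angle A (fun v => x v) v * ((x v).val : ℝ) : ℝ) : ℂ))) *
        (∏ v ∈ A, ketBra (phaseKet 0) (x v) (y v)) *
        star (∏ v ∈ A, Complex.exp (Complex.I *
          ((G.angle A (fun v => x v) v * ((y v).val : ℝ) : ℝ) : ℂ))) := by
      rw [star_prod, ← Finset.prod_mul_distrib, ← Finset.prod_mul_distrib]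
      refine Finset.prod_congr rfl fun v _ => ?_
      simp only [ketBra, Matrix.vecMulVec_apply, Pi.star_apply]
      rw [phaseKet_apply _ (x v), phaseKet_apply (G.angle A _ v) (y v), star_mul']
      ring
    rw [htens, hprod, G.edgePhase_eq hA x, G.edgePhase_eq hA y, hrest, ← hxy, star_mul']
    linear_combination (-(∏ v ∈ A, Complex.exp (Complex.I *
          ((G.angle A (fun v => x v) v * ((x v).val : ℝ) : ℝ) : ℂ))) *
        (∏ v ∈ A, ketBra (phaseKet 0) (x v) (y v)) *
        star (∏ v ∈ A, Complex.exp (Complex.I *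
          ((G.angle A (fun v => x v) v * ((y v).val : ℝ) : ℝ) : ℂ)))) * hR
  · push Not at h
    obtain ⟨v, hv, hne⟩ := h
    have : tensorOp (fun v => if v ∈ A then ketBra (phaseKet 0) else 1) x y = 0 := by
      refine Finset.prod_eq_zero (Finset.mem_univ v) ?_
      beta_reduce
      rw [if_neg hv, Matrix.one_apply_ne hne]
    rw [this, mul_zero, zero_mul]

/-- The unitary whose columns are the weighted graph basis. -/
def graphBasis : Matrix (V → Fin 2) (V → Fin 2) ℂ :=
  Matrix.diagonal G.edgePhase * tensorOp fun _ => hadamard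

theorem graphBasis_mem_unitary : G.graphBasis ∈ Matrix.unitaryGroup (V → Fin 2) ℂ := by
  refine mul_mem ?_ (tensorOp_mem_unitary fun _ => hadamard_mem_unitary)
  rw [Matrix.mem_unitaryGroup_iff, Matrix.star_eq_conjTranspose, Matrix.diagonal_conjTranspose,
    Matrix.diagonal_mul_diagonal, ← Matrix.diagonal_one]
  congr 1
  funext x
  exact G.prod_controlledPhase_mul_star _ x

/-- The indicator function of the labels that vanish on `A`. -/
def vanishOn (A : Finset V) (s : V → Fin 2) : ℝ := if ∀ v ∈ A, s v = 0 then 1 else 0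

theorem conjDiag_graphBasis_vanishOn (A : Finset V) :
    conjDiag G.graphBasis (vanishOn A) = Matrix.diagonal G.edgePhase *
      tensorOp (fun v => if v ∈ A then ketBra (phaseKet 0) else 1) *
      (Matrix.diagonal G.edgePhase).conjTranspose := by
  have h : (fun v => if v ∈ A then ketBra (phaseKet 0) else 1) =
      fun v => conjDiag hadamard (if v ∈ A then Pi.single 0 1 else 1) := by
    funext v
    split_ifs
    · exact conjDiag_hadamard.symm
    · exact (conjDiag_one hadamard_mem_unitary).symm
  have h2 : vanishOn A = fun s : V → Fin 2 =>
      ∏ v, (if v ∈ A then Pi.single 0 1 else (1 : Fin 2 → ℝ)) (s v) := by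
    funext s
    rw [vanishOn]
    split_ifs with hs
    · refine (Finset.prod_eq_one fun v _ => ?_).symm
      split_ifs with hv
      · rw [hs v hv, Pi.single_eq_same]
      · rfl
    · push Not at hs
      obtain ⟨v, hv, hne⟩ := hs
      refine (Finset.prod_eq_zero (Finset.mem_univ v) ?_).symm
      rw [if_pos hv, Pi.single_eq_of_ne hne]
  rw [h, tensorOp_conjDiag, ← h2, conjDiag_apply, conjDiag_apply, graphBasis,
    Matrix.conjTranspose_mul]
  simp only [mul_assoc]

theorem pProj_eq_conjDiag {A : Finset V} (hA : G.graph.IsIndepSet (A : Set V)) :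
    G.pProj A = conjDiag G.graphBasis (vanishOn A) := by
  ext x y
  rw [pProj_eq_adaptiveAcceptOp, G.adaptiveAcceptOp_apply hA, conjDiag_graphBasis_vanishOn,
    Matrix.diagonal_conjTranspose, Matrix.mul_diagonal, Matrix.diagonal_mul]
  rfl

/-- The graph state is the case where every vertex carries `|+⟩⟨+|`. The set `Finset.univ` need not
be independent, since `conjDiag_graphBasis_vanishOn` holds for all sets. -/
theorem ketBra_state_eq_conjDiag :
    ketBra G.state = conjDiag G.graphBasis (Pi.single 0 1) := by
  have h : (Pi.single 0 1 : (V → Fin 2) → ℝ) = vanishOn Finset.univ := by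
    funext s
    simp [vanishOn, Pi.single_apply, funext_iff]
  ext x y
  rw [h, conjDiag_graphBasis_vanishOn,
    Matrix.diagonal_conjTranspose, Matrix.mul_diagonal, Matrix.diagonal_mul]
  simp only [ketBra, Matrix.vecMulVec_apply, Pi.star_apply, state_apply, star_mul', star_prod,
    tensorOp, Matrix.of_apply, Finset.mem_univ, if_true, Finset.prod_mul_distrib]
  ring

end State

/-! ### Spectrum of the test operator -/

/-- The eigenvalue of the test operator at the graph basis vector with label `s`. -/
def testEigenvalue {m : ℕ} (A : Fin m → Finset V) : (V → Fin 2) → ℝ :=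
  ∑ l, (m : ℝ)⁻¹ • vanishOn (A l)

theorem testEigenvalue_apply {m : ℕ} (A : Fin m → Finset V) (s : V → Fin 2) :
    testEigenvalue A s = (m : ℝ)⁻¹ * ∑ l, vanishOn (A l) s := by
  simp [testEigenvalue, Finset.mul_sum]

theorem testEigenvalue_nonneg {m : ℕ} (A : Fin m → Finset V) : 0 ≤ testEigenvalue A := by
  intro s
  rw [Pi.zero_apply, testEigenvalue_apply]
  refine mul_nonneg (by positivity) (Finset.sum_nonneg fun l _ => ?_)
  rw [vanishOn]
  positivity

theorem testEigenvalue_zero {m : ℕ} (hm : 0 < m) (A : Fin m → Finset V) :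
    testEigenvalue A 0 = 1 := by
  have hm' : (m : ℝ) ≠ 0 := by exact_mod_cast hm.ne'
  rw [testEigenvalue_apply]
  simp [vanishOn, hm']

theorem sum_ite_eq_zero_one {m : ℕ} (l₀ : Fin m) :
    ∑ l : Fin m, (if l = l₀ then (0 : ℝ) else 1) = m - 1 := by
  have h : ∀ l : Fin m, (if l = l₀ then (0 : ℝ) else 1) = 1 - if l = l₀ then 1 else 0 := by
    intro l
    split_ifs <;> simp
  simp [h]

section Cover

variable {G : WeightedGraph V} {m : ℕ} {A : Fin m → Finset V}

theorem IsIndependenceCover.testEigenvalue_le (hA : G.IsIndependenceCover A)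
    {s : V → Fin 2} (hs : s ≠ 0) : testEigenvalue A s ≤ 1 - 1 / (m : ℝ) := by
  obtain ⟨k, hk⟩ := Function.ne_iff.1 hs
  -- The member containing a vertex where `s` is nonzero contributes `0`, so at most `m - 1` members
  -- count.
  obtain ⟨l₀, hl₀⟩ := hA.cover k
  have hm : (0 : ℝ) < m := by exact_mod_cast l₀.pos
  have h : ∑ l, vanishOn (A l) s ≤ m - 1 := by
    rw [← sum_ite_eq_zero_one l₀]
    refine Finset.sum_le_sum fun l _ => ?_
    rw [vanishOn]
    split_ifs with h1 h2 h2
    · subst h2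
      exact absurd (h1 k hl₀) hk
    all_goals norm_num
  rw [testEigenvalue_apply]
  refine (mul_le_mul_of_nonneg_left h (inv_nonneg.2 hm.le)).trans_eq ?_
  field_simp

theorem IsIndependenceCover.testEigenvalue_single (hA : G.IsIndependenceCover A) (k : V) :
    testEigenvalue A (Pi.single k 1) = 1 - 1 / (m : ℝ) := by
  obtain ⟨l₀, hl₀⟩ := hA.cover k
  have hm : (0 : ℝ) < m := by exact_mod_cast l₀.pos
  have h : ∑ l, vanishOn (A l) (Pi.single k 1) = m - 1 := by
    rw [← sum_ite_eq_zero_one l₀]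
    refine Finset.sum_congr rfl fun l _ => ?_
    rw [vanishOn]
    by_cases hl : l = l₀
    · subst hl
      rw [if_pos rfl, if_neg]
      intro h
      simpa using h k hl₀
    · rw [if_neg hl, if_pos]
      intro v hv
      refine Pi.single_eq_of_ne ?_ _
      rintro rfl
      -- Disjointness makes `A l₀` the only member that detects the flip at `k`.
      exact Finset.disjoint_left.1 (hA.disjoint l l₀ hl) hv hl₀
  rw [testEigenvalue_apply, h]
  field_simp

theorem IsIndependenceCover.testEigenvalue_le_one (hA : G.IsIndependenceCover A) [Nonempty V] :
    testEigenvalue A ≤ 1 := by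
  intro s
  by_cases hs : s = 0
  · subst hs
    exact (testEigenvalue_zero hA.pos A).le
  · refine (hA.testEigenvalue_le hs).trans ?_
    have : (0 : ℝ) ≤ 1 / m := by positivity
    rw [Pi.one_apply]
    linarith

theorem IsIndependenceCover.testOp_eq_conjDiag [DecidableRel G.graph.Adj]
    (hA : G.IsIndependenceCover A) :
    G.testOp A = conjDiag G.graphBasis (testEigenvalue A) := by
  rw [testOp, testEigenvalue, map_sum]
  refine Finset.sum_congr rfl fun l _ => ?_
  rw [map_smul, G.pProj_eq_conjDiag (hA.indep l)]
  ext x y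
  simp

theorem IsIndependenceCover.single_le_testEigenvalue [Nonempty V]
    (hA : G.IsIndependenceCover A) : Pi.single 0 1 ≤ testEigenvalue A := by
  intro s
  by_cases hs : s = 0
  · subst hs
    rw [Pi.single_eq_same, testEigenvalue_zero hA.pos A]
  · rw [Pi.single_eq_of_ne hs]
    exact testEigenvalue_nonneg A s

theorem IsIndependenceCover.spectralGap_eq [Nonempty V] [DecidableRel G.graph.Adj]
    (hA : G.IsIndependenceCover A) :
    spectralGap G.state (G.testOp A) = 1 / (m : ℝ) := by
  have hm : (1 : ℝ) ≤ m := by exact_mod_cast hA.pos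
  have hc : 0 ≤ 1 - 1 / (m : ℝ) := by
    rw [sub_nonneg, div_le_one (by linarith)]
    exact hm
  have hnorm : ‖testEigenvalue A - Pi.single 0 1‖ = 1 - 1 / (m : ℝ) := by
    refine le_antisymm ((pi_norm_le_iff_of_nonneg hc).2 fun s => ?_) ?_
    · rw [Real.norm_of_nonneg (sub_nonneg.2 hA.single_le_testEigenvalue s)]
      by_cases hs : s = 0
      · subst hs
        rw [Pi.sub_apply, Pi.single_eq_same, testEigenvalue_zero hA.pos A, sub_self]
        exact hc
      · rw [Pi.sub_apply, Pi.single_eq_of_ne hs, sub_zero]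
        exact hA.testEigenvalue_le hs
    -- The supremum is attained at the label with a single `1`, at an arbitrary vertex.
    · obtain ⟨k⟩ := ‹Nonempty V›
      have hk : (Pi.single k 1 : V → Fin 2) ≠ 0 := by simp
      have h := norm_le_pi_norm (testEigenvalue A - Pi.single 0 1) (Pi.single k 1)
      rw [Pi.sub_apply, Pi.single_eq_of_ne hk, sub_zero, hA.testEigenvalue_single] at h
      exact (le_abs_self _).trans h
  rw [spectralGap, hA.testOp_eq_conjDiag, ketBra_state_eq_conjDiag, ← map_sub,
    norm_conjDiag G.graphBasis_mem_unitary, hnorm]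
  ring

theorem IsIndependenceCover.passProb_state [Nonempty V] [DecidableRel G.graph.Adj]
    (hA : G.IsIndependenceCover A) (N : ℕ) :
    RandomSampling.passProb (N := N) (G.testOp A)
      (tensorOp fun _ : Fin (N + 1) => ketBra G.state) = 1 := by
  have hmul : G.testOp A * ketBra G.state = ketBra G.state := by
    rw [hA.testOp_eq_conjDiag, ketBra_state_eq_conjDiag, conjDiag_mul G.graphBasis_mem_unitary]
    congr 1
    funext s
    by_cases hs : s = 0
    · subst hs
      rw [Pi.mul_apply, testEigenvalue_zero hA.pos A, one_mul]
    · rw [Pi.mul_apply, Pi.single_eq_of_ne hs, mul_zero]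
  have htrace : (ketBra G.state).trace = 1 := by
    rw [ketBra_state_eq_conjDiag, trace_conjDiag G.graphBasis_mem_unitary, ← Complex.ofReal_sum]
    simp
  have h : ∀ j : Fin (N + 1), (RandomSampling.passOp (G.testOp A) j *
      tensorOp fun _ : Fin (N + 1) => ketBra G.state).trace = 1 := by
    intro j
    rw [RandomSampling.passOp, tensorOp_mul, trace_tensorOp]
    refine Finset.prod_eq_one fun i _ => ?_
    split_ifs
    · rw [one_mul, htrace]
    · rw [hmul, htrace]
  rw [RandomSampling.passProb]
  simp only [h, Complex.one_re, Finset.sum_const, Finset.card_univ, Fintype.card_fin]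
  have : (N : ℝ) + 1 ≠ 0 := by positivity
  simp [this]

end Cover

end WeightedGraph

end

theorem theorem1 {V : Type*} [Fintype V] [DecidableEq V] [Nonempty V]
    (G : WeightedGraph V) [DecidableRel G.graph.Adj]
    {m : ℕ} (A : Fin m → Finset V) (hA : G.IsIndependenceCover A) :
    -- each `P_l` is implemented by the adaptive single-qubit measurement
    (∀ l, G.pProj (A l) = G.adaptiveAcceptOp (A l)) ∧
    -- `0 ≤ Ω(𝒜) ≤ I` and `Ω(𝒜) ≥ |G⟩⟨G|`, with spectral gap `1 / m`
    IsTestOperator (G.testOp A) ∧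
    (G.testOp A - ketBra G.state).PosSemidef ∧
    spectralGap G.state (G.testOp A) = 1 / (m : ℝ) ∧
    -- the ideal state passes with probability one
    (∀ N : ℕ, RandomSampling.passProb (N := N) (G.testOp A)
      (tensorOp fun _ : Fin (N + 1) => ketBra G.state) = 1) ∧
    -- soundness at significance level `β`, for an arbitrary joint state of the `N + 1` copies
    (∀ N : ℕ, 1 ≤ N → ∀ β : ℝ, 0 < β →
      ∀ ρ : Matrix (Fin (N + 1) → V → Fin 2) (Fin (N + 1) → V → Fin 2) ℂ,
        IsDensityOperator ρ →
        β ≤ RandomSampling.passProb (G.testOp A) ρ →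
        1 - (m : ℝ) * (1 - β) / ((N : ℝ) * β) ≤
          fidelityWith G.state (RandomSampling.remainingState (G.testOp A) ρ)) := by
  have hm : (1 : ℝ) ≤ m := by exact_mod_cast hA.pos
  have hΩ := hA.testOp_eq_conjDiag
  have hW := G.graphBasis_mem_unitary
  refine ⟨fun l => G.pProj_eq_adaptiveAcceptOp (A l), ⟨?_, ?_⟩, ?_, hA.spectralGap_eq,
    hA.passProb_state, fun N hN β hβ ρ hρ hpass => ?_⟩
  · rw [hΩ]
    exact conjDiag_posSemidef (WeightedGraph.testEigenvalue_nonneg A)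
  -- Writing the identity in the graph basis reduces the operator inequality to one between
  -- eigenvalues.
  · rw [hΩ, ← conjDiag_one hW, ← map_sub]
    exact conjDiag_posSemidef (sub_nonneg.2 hA.testEigenvalue_le_one)
  · rw [hΩ, G.ketBra_state_eq_conjDiag, ← map_sub]
    exact conjDiag_posSemidef (sub_nonneg.2 hA.single_le_testEigenvalue)
  · rw [hΩ] at hpass ⊢
    exact RandomSampling.le_fidelityWith_remainingState hW G.ketBra_state_eq_conjDiag hm
      (WeightedGraph.testEigenvalue_nonneg A) (WeightedGraph.testEigenvalue_zero hA.pos A)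
      (fun s hs => hA.testEigenvalue_le hs) hN hβ hρ hpass
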